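/- Let $d\in\mathbb N$ and $\varepsilon,\tau,\lambda,d_1,d_2>0$. Let $u^0,v^0\in L^\infty(\mathbb R^d)$ and let $p^0$ be measurable on $\mathbb R^d$, with $$0\le u^0\le \|u^0\|_{L^\infty(\mathbb R^d)},\qquad 0\le v^0\le\|v^0\|_{L^\infty(\mathbb R^d)},\qquad 0\le p^0\le 1\quad\text{a.e.}$$ Consider the time-semi-discrete semi-implicit scheme, for $n=0,1,2,\dots$, $$\frac{p^{n+1}-p^n}{\tau}=\frac1\varepsilon\left[(1-p^{n+1})u^n-v^np^{n+1}\right],$$ $$\frac{u^{n+1}-u^n}{\tau}-d_1\Delta u^{n+1}=-\frac1\varepsilon u^{n+1}\left[v^n+\lambda(1-p^{n+1})\right],$$ $$\frac{v^{n+1}-v^n}{\tau}-d_2\Delta v^{n+1}=-\frac1\varepsilon v^{n+1}\left(u^{n+1}+\lambda p^{n+1}\right)$$ on $\mathbb R^d$, where $u^n,v^n\in L^\infty(\mathbb R^d)$, the equations hold almost everywhere, and $\Delta u^{n+1}$, $\Delta v^{n+1}$ are locally integrable functions that are the Laplacians in the sense of distributions. Then the scheme has a solution $(u^n,v^n,p^n)_{n\ge0}$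 starting from $(u^0,v^0,p^0)$, it is unique up to equality almost everywhere, and for all $n\ge 0$, almost everywhere on $\mathbb R^d$, $$0\le u^n\le \|u^0\|_{L^\infty(\mathbb R^d)},\qquad 0\le v^n\le\|v^0\|_{L^\infty(\mathbb R^d)},\qquad 0\le p^n\le 1 .$$ Moreover, for $D\in\{d_1,d_2\}$ and every $c\in L^\infty(\mathbb R^d)$ with $c\ge0$ a.e., the operator $\mathcal L=\left(1+\frac{\tau}{\varepsilon}c\right)-D\tau\Delta$ is invertible on $L^\infty(\mathbb R^d)$: for every $f\in L^\infty(\mathbb R^d)$ the equation $\mathcal Lw=f$ has exactly one solution $w=\mathcal L^{-1}f\in L^\infty(\mathbb R^d)$ (with $\Delta w$ as above). Its inverse is positivity preserving ($f\ge0$ a.e. implies $\mathcal L^{-1}f\ge0$ a.e.) and contractive: $\|\mathcal L^{-1}f\|_{L^\infty(\mathbb R^d)}\le\|f\|_{L^\infty(\mathbb R^d)}$. -/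

import Mathlib

open MeasureTheory
open scoped ENNReal ContDiff Laplacian

/-- The function `g` is the Laplacian of `w` on `ℝ^d` in the sense of distributions: both are locally
integrable and `∫ w Δφ = ∫ g φ` for every smooth compactly supported test function `φ`. -/
def HasWeakLaplacian {d : ℕ} (w g : EuclideanSpace ℝ (Fin d) → ℝ) : Prop :=
  LocallyIntegrable w ∧ LocallyIntegrable g ∧
    ∀ φ : EuclideanSpace ℝ (Fin d) → ℝ, ContDiff ℝ ∞ φ → HasCompactSupport φ →
      ∫ x, w x * (Δ φ) x = ∫ x, g x * φ x

/-- The essential supremum norm of a function on `ℝ^d`, as a real number. -/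
noncomputable def supNorm {d : ℕ} (f : EuclideanSpace ℝ (Fin d) → ℝ) : ℝ :=
  (eLpNorm f ∞ volume).toReal

/-- `w` is a solution in `L^∞(ℝ^d)` of `a w - κ Δ w = f`. -/
def SolvesElliptic {d : ℕ} (a : EuclideanSpace ℝ (Fin d) → ℝ) (κ : ℝ)
    (w f : EuclideanSpace ℝ (Fin d) → ℝ) : Prop :=
  MemLp w ∞ volume ∧ ∃ g, HasWeakLaplacian w g ∧ ∀ᵐ x, a x * w x - κ * g x = f x

/-- `(u n, v n, p n)` are iterates, with `u n` and `v n` in `L^∞(ℝ^d)`, of the semi-discrete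
semi-implicit scheme with time step `τ`, started at `(u0, v0, p0)`. The equations hold almost
everywhere and the Laplacians are taken in the sense of distributions. -/
structure IsSemiImplicitSolution {d : ℕ} (ε τ lam d₁ d₂ : ℝ)
    (u0 v0 p0 : EuclideanSpace ℝ (Fin d) → ℝ)
    (u v p : ℕ → EuclideanSpace ℝ (Fin d) → ℝ) : Prop where
  memLp_u : ∀ n, MemLp (u n) ∞ volume
  memLp_v : ∀ n, MemLp (v n) ∞ volume
  initial_u : u 0 =ᵐ[volume] u0
  initial_v : v 0 =ᵐ[volume] v0
  initial_p : p 0 =ᵐ[volume] p0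
  step_p : ∀ n, ∀ᵐ x, (p (n + 1) x - p n x) / τ
    = 1 / ε * ((1 - p (n + 1) x) * u n x - v n x * p (n + 1) x)
  step_u : ∀ n, ∃ g, HasWeakLaplacian (u (n + 1)) g ∧
    ∀ᵐ x, (u (n + 1) x - u n x) / τ - d₁ * g x
      = -(1 / ε) * u (n + 1) x * (v n x + lam * (1 - p (n + 1) x))
  step_v : ∀ n, ∃ g, HasWeakLaplacian (v (n + 1)) g ∧
    ∀ᵐ x, (v (n + 1) x - v n x) / τ - d₂ * g x
      = -(1 / ε) * v (n + 1) x * (u (n + 1) x + lam * p (n + 1) x)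

/-- The bounds `0 ≤ u ≤ U`, `0 ≤ v ≤ V`, `0 ≤ p ≤ 1` almost everywhere on `ℝ^d`. -/
def WithinBounds {d : ℕ} (U V : ℝ) (u v p : EuclideanSpace ℝ (Fin d) → ℝ) : Prop :=
  ∀ᵐ x, (0 ≤ u x ∧ u x ≤ U) ∧ (0 ≤ v x ∧ v x ≤ V) ∧ (0 ≤ p x ∧ p x ≤ 1)

/-!
The operator `1 - s Δ` is inverted by averaging over a probability measure. If `r` is an exponential
time and `z` an independent standard Gaussian vector, then the law of `√(2 s r) z` has characteristic
function `1 / (1 + s ‖ξ‖²)` (`charFun_besselMeasure`), the reciprocal of the symbol of `1 - s Δ`.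
Fourier inversion gives the inverse on Schwartz functions
(`integral_besselMeasure_sub_smul_laplacian`), where `1 - s Δ` is also onto
(`exists_sub_smul_laplacian_eq`). By duality, `R f (x) = ∫ f (x + y)` over this measure solves
`w - s Δ w = f` for bounded `f` (`hasWeakLaplacian_translationAverage`), and every bounded `w` with
bounded distributional Laplacian is `R (w - s Δ w)` (`HasWeakLaplacian.ae_eq_translationAverage`);
the latter uses a cutoff argument to test the weak Laplacian against Schwartz functions. As an
average, `R` is monotone and fixes constants.

For variable `a ≥ 1` with upper bound `A`, the equation `a w - κ Δ w = f` becomes the fixed-point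
equation `w = R (f / A + (1 - a / A) w)` with `s = κ / A` (`solvesElliptic_iff`), in which the factor
`1 - a / A` lies in `[0, 1 - 1 / A]`. Banach's theorem in `L^∞` gives existence. Iterating the
inequality that the difference of two solutions satisfies gives the comparison principle
(`SolvesElliptic.ae_le`), from which uniqueness, positivity and the bound by the data follow, the
last by comparison with constants.

In the scheme the equation for `p` is solved explicitly and exhibits the new value as a convex
combination of `p`, `1` and `0`; the equations for `u` and `v` are then elliptic with
`a = 1 + (τ/ε) c` and `c ≥ 0` bounded. Induction on the step carries existence, uniqueness and bounds.
-/

/-! ### Bounded functions -/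

section EssentialBounds

variable {α : Type*} [MeasurableSpace α] {μ : Measure α} {f g : α → ℝ}

lemma MeasureTheory.MemLp.ae_abs_le (hf : MemLp f ∞ μ) :
    ∀ᵐ x ∂μ, |f x| ≤ (eLpNorm f ∞ μ).toReal := by
  filter_upwards [ae_le_eLpNormEssSup (f := f) (μ := μ)] with x hx
  rw [← eLpNorm_exponent_top] at hx
  exact ENNReal.toReal_mono hf.2.ne hx

lemma MeasureTheory.MemLp.exists_ae_abs_le (hf : MemLp f ∞ μ) :
    ∃ C, 0 ≤ C ∧ ∀ᵐ x ∂μ, |f x| ≤ C :=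
  ⟨_, ENNReal.toReal_nonneg, hf.ae_abs_le⟩

lemma toReal_eLpNorm_top_le {C : ℝ} (hC : 0 ≤ C) (h : ∀ᵐ x ∂μ, |f x| ≤ C) :
    (eLpNorm f ∞ μ).toReal ≤ C := by
  rw [eLpNorm_exponent_top]
  exact ENNReal.toReal_le_of_le_ofReal hC (eLpNormEssSup_le_of_ae_bound h)

lemma MeasureTheory.MemLp.mul_top (hf : MemLp f ∞ μ) (hg : MemLp g ∞ μ) :
    MemLp (fun x => f x * g x) ∞ μ :=
  hg.mul' hf

end EssentialBounds

/-! ### Averages over translates -/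

section TranslationAverage

variable {E : Type*} [NormedAddCommGroup E] [InnerProductSpace ℝ E] [FiniteDimensional ℝ E]
  [MeasurableSpace E] [BorelSpace E]

/-- The average `x ↦ ∫ f (x + y) dγ(y)` of the translates of `f` over a measure `γ`. -/
noncomputable def translationAverage (γ : Measure E) (f : E → ℝ) (x : E) : ℝ :=
  ∫ y, f (x + y) ∂γ

variable {γ : Measure E} [IsProbabilityMeasure γ] {f g : E → ℝ}

lemma quasiMeasurePreserving_add_prod (γ : Measure E) [IsProbabilityMeasure γ] :
    Measure.QuasiMeasurePreserving (fun z : E × E => z.1 + z.2) (volume.prod γ) volume :=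
  Measure.quasiMeasurePreserving_fst.comp
    (measurePreserving_add_prod (volume : Measure E) γ).quasiMeasurePreserving

/-- Averages over translates do not depend on the choice of representative: the sum map
`(x, y) ↦ x + y` pulls Lebesgue null sets back to null sets, whatever `γ` is. -/
lemma ae_ae_add_of_ae (γ : Measure E) [IsProbabilityMeasure γ] {P : E → Prop}
    (h : ∀ᵐ x, P x) : ∀ᵐ x, ∀ᵐ y ∂γ, P (x + y) :=
  Measure.ae_ae_of_ae_prod ((quasiMeasurePreserving_add_prod γ).ae h)

lemma ae_integrable_comp_add (hf : MemLp f ∞ volume) :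
    ∀ᵐ x, Integrable (fun y => f (x + y)) γ := by
  obtain ⟨C, -, hC⟩ := hf.exists_ae_abs_le
  have hm : AEStronglyMeasurable (fun z : E × E => f (z.1 + z.2)) (volume.prod γ) :=
    hf.1.comp_quasiMeasurePreserving (quasiMeasurePreserving_add_prod γ)
  filter_upwards [hm.prodMk_left, ae_ae_add_of_ae γ hC] with x hx hb
  exact Integrable.of_bound hx C (by simpa using hb)

lemma aestronglyMeasurable_translationAverage (hf : AEStronglyMeasurable f volume) :
    AEStronglyMeasurable (translationAverage γ f) volume :=
  (hf.comp_quasiMeasurePreserving (quasiMeasurePreserving_add_prod γ)).integral_prod_right'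

lemma translationAverage_mono (hf : MemLp f ∞ volume) (hg : MemLp g ∞ volume)
    (h : ∀ᵐ x, f x ≤ g x) : ∀ᵐ x, translationAverage γ f x ≤ translationAverage γ g x := by
  filter_upwards [ae_ae_add_of_ae γ h, ae_integrable_comp_add (γ := γ) hf,
    ae_integrable_comp_add (γ := γ) hg]
    with x hx h1 h2
  exact integral_mono_ae h1 h2 hx

lemma translationAverage_sub (hf : MemLp f ∞ volume) (hg : MemLp g ∞ volume) :
    ∀ᵐ x, translationAverage γ (fun z => f z - g z) x
      = translationAverage γ f x - translationAverage γ g x := by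
  filter_upwards [ae_integrable_comp_add (γ := γ) hf,
    ae_integrable_comp_add (γ := γ) hg] with x h1 h2
  exact integral_sub h1 h2

lemma ae_abs_translationAverage_le {C : ℝ} (hC : ∀ᵐ x, |f x| ≤ C) :
    ∀ᵐ x, |translationAverage γ f x| ≤ C := by
  filter_upwards [ae_ae_add_of_ae γ hC] with x hx
  simpa [translationAverage] using norm_integral_le_of_norm_le_const (μ := γ) (C := C)
    (f := fun y => f (x + y)) (by simpa using hx)

lemma memLp_translationAverage (hf : MemLp f ∞ volume) :
    MemLp (translationAverage γ f) ∞ volume := by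
  obtain ⟨C, -, hC⟩ := hf.exists_ae_abs_le
  exact memLp_top_of_bound (aestronglyMeasurable_translationAverage hf.1) C
    (ae_abs_translationAverage_le hC)

/-- Averaging over `γ` is adjoint to averaging over the reflected measure: both sides are
integrals over the product `E × E`, which the shear `(x, y) ↦ (x + y, y)` identifies. -/
lemma integral_translationAverage_mul (hf : MemLp f ∞ volume) {ψ : E → ℝ}
    (hψ : Integrable ψ volume) :
    ∫ x, translationAverage γ f x * ψ x = ∫ x, f x * ∫ y, ψ (x - y) ∂γ := by
  have hτ := measurePreserving_add_prod (volume : Measure E) γ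
  let F : E × E → ℝ := fun z => f z.1 * ψ (z.1 - z.2)
  have hFτ : (fun z : E × E => f (z.1 + z.2) * ψ z.1) = F ∘ (fun z => (z.1 + z.2, z.2)) := by
    ext z; simp [F]
  have hemb : MeasurableEmbedding (fun z : E × E => (z.1 + z.2, z.2)) :=
    (MeasurableEquiv.mk ⟨fun z : E × E => (z.1 + z.2, z.2), fun z => (z.1 - z.2, z.2),
      fun z => by simp, fun z => by simp⟩
      (by dsimp; fun_prop) (by dsimp; fun_prop)).measurableEmbedding
  obtain ⟨C, -, hC⟩ := hf.exists_ae_abs_le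
  have hint : Integrable (fun z : E × E => f (z.1 + z.2) * ψ z.1) (volume.prod γ) := by
    refine (hψ.comp_fst γ).bdd_mul (c := C)
      (hf.1.comp_quasiMeasurePreserving (quasiMeasurePreserving_add_prod γ)) ?_
    exact (quasiMeasurePreserving_add_prod γ).ae hC
  have hint' : Integrable F (volume.prod γ) := by
    rw [hFτ] at hint
    exact (hτ.integrable_comp_emb hemb).1 hint
  calc ∫ x, translationAverage γ f x * ψ x
      = ∫ x, ∫ y, f (x + y) * ψ x ∂γ := by simp_rw [translationAverage, integral_mul_const]
    _ = ∫ z, f (z.1 + z.2) * ψ z.1 ∂(volume.prod γ) := (integral_prod _ hint).symm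
    _ = ∫ z, F z ∂(volume.prod γ) := by rw [hFτ]; exact hτ.integral_comp hemb F
    _ = ∫ x, ∫ y, f x * ψ (x - y) ∂γ := integral_prod _ hint'
    _ = ∫ x, f x * ∫ y, ψ (x - y) ∂γ := by simp_rw [integral_const_mul]

end TranslationAverage

/-! ### The measure with characteristic function `1 / (1 + s‖ξ‖²)` -/

section BesselMeasure

open ProbabilityTheory

lemma integral_exp_neg_mul_expMeasure {b : ℝ} (hb : 0 ≤ b) :
    ∫ r, Real.exp (-(b * r)) ∂(expMeasure 1) = (1 + b)⁻¹ := by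
  have h1 : ∀ᵐ r ∂(volume : Measure ℝ), gammaPDF 1 1 r < ⊤ := by
    exact Filter.Eventually.of_forall fun r => by simp [gammaPDF]
  rw [expMeasure, gammaMeasure, integral_withDensity_eq_integral_toReal_smul
    (show Measurable (gammaPDF 1 1) from (measurable_gammaPDFReal 1 1).ennreal_ofReal) h1]
  have h2 : (fun r : ℝ => (gammaPDF 1 1 r).toReal • Real.exp (-(b * r)))
      = (Set.Ici (0 : ℝ)).indicator (fun r => Real.exp (-(1 + b) * r)) := by
    ext r
    by_cases hr : 0 ≤ r
    · rw [Set.indicator_of_mem (by simpa using hr), gammaPDF_of_nonneg hr]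
      rw [ENNReal.toReal_ofReal (by positivity)]
      simp [← Real.exp_add]
      ring_nf
    · rw [Set.indicator_of_notMem (by simpa using hr), gammaPDF_of_neg (by linarith)]
      simp
  rw [h2, integral_indicator measurableSet_Ici, integral_Ici_eq_integral_Ioi,
    integral_exp_mul_Ioi (by linarith)]
  rw [mul_zero, Real.exp_zero, neg_div_neg_eq, one_div]

variable (E : Type*) [NormedAddCommGroup E] [InnerProductSpace ℝ E] [FiniteDimensional ℝ E]
  [MeasurableSpace E] [BorelSpace E]

/-- The law of `√(2 s r) z` for an exponential time `r` of mean `1` and an independent standard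
Gaussian vector `z`: a Brownian motion at an exponential time. Its density is the kernel of the
resolvent `(1 - s Δ)⁻¹`. -/
noncomputable def besselMeasure (s : ℝ) : Measure E :=
  ((expMeasure 1).prod (stdGaussian E)).map (fun z => √(2 * s * z.1) • z.2)

lemma isProbabilityMeasure_besselMeasure (s : ℝ) : IsProbabilityMeasure (besselMeasure E s) := by
  have := isProbabilityMeasure_expMeasure (r := 1) one_pos
  exact Measure.isProbabilityMeasure_map (Measurable.aemeasurable (by fun_prop))

lemma charFun_besselMeasure {s : ℝ} (hs : 0 < s) (t : E) :
    charFun (besselMeasure E s) t = ((1 + s * ‖t‖ ^ 2)⁻¹ : ℝ) := by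
  have := isProbabilityMeasure_expMeasure (r := 1) one_pos
  rw [charFun_apply, besselMeasure, integral_map (Measurable.aemeasurable (by fun_prop))
    (Measurable.aestronglyMeasurable (by fun_prop)), integral_prod]
  · -- given `r`, the law is Gaussian; what remains is the Laplace transform of `r`
    have h : ∀ᵐ r ∂(expMeasure 1), (∫ z, Complex.exp
        ((inner ℝ (√(2 * s * (r, z).1) • (r, z).2) t : ℝ) * Complex.I) ∂(stdGaussian E))
        = ((Real.exp (-(s * ‖t‖ ^ 2 * r)) : ℝ) : ℂ) := by
      have hpos : ∀ᵐ r ∂(expMeasure 1), 0 ≤ r := by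
        rw [ae_iff, expMeasure, gammaMeasure, withDensity_apply _ (by measurability)]
        simp only [not_le]
        exact lintegral_gammaPDF_of_nonpos le_rfl
      filter_upwards [hpos] with r hr
      have := charFun_stdGaussian (E := E) (√(2 * s * r) • t)
      rw [charFun_apply] at this
      simp only [real_inner_smul_left]
      simp only [real_inner_smul_right] at this
      rw [this, norm_smul, Complex.ofReal_exp, ← Complex.ofReal_pow, mul_pow, Real.norm_eq_abs,
        sq_abs, Real.sq_sqrt (by positivity)]
      push_cast
      congr 1
      ring
    rw [integral_congr_ae h, integral_complex_ofReal,
      integral_exp_neg_mul_expMeasure (by positivity)]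
  · refine Integrable.of_bound (C := 1) (Measurable.aestronglyMeasurable (by fun_prop)) ?_
    exact Filter.Eventually.of_forall fun z => (Complex.norm_exp_ofReal_mul_I _).le

end BesselMeasure

/-! ### The resolvent on Schwartz functions -/

section Schwartz

open SchwartzMap FourierTransform Complex

variable {E : Type*} [NormedAddCommGroup E] [InnerProductSpace ℝ E] [FiniteDimensional ℝ E]

lemma laplacian_comp_clm {F G : Type*} [NormedAddCommGroup F] [NormedSpace ℝ F]
    [NormedAddCommGroup G] [NormedSpace ℝ G] (L : F →L[ℝ] G) (φ : 𝓢(E, F)) (x : E) :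
    (Δ (φ.postcompCLM L)) x = L ((Δ φ) x) := by
  rw [laplacian_apply, laplacian_apply]
  exact ContDiffAt.laplacian_CLM_comp_left ((φ.smooth 2).contDiffAt)

variable [MeasurableSpace E] [BorelSpace E]

/-- The symbol of `1 - s Δ` is `1 + s ‖2πξ‖²`. -/
lemma fourier_sub_smul_laplacian (s : ℝ) (φ : 𝓢(E, ℂ)) (ξ : E) :
    (𝓕 (φ - s • Δ φ)) ξ = (1 + s * ‖(2 * Real.pi) • ξ‖ ^ 2 : ℝ) • (𝓕 φ) ξ := by
  have h : 𝓕 (Δ φ) = -(2 * Real.pi) ^ 2 • smulLeftCLM ℂ (fun x : E => ‖x‖ ^ 2) (𝓕 φ) := by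
    rw [laplacian_eq_fourierMultiplierCLM, fourierMultiplierCLM_apply,
      ← FourierTransform.fourierInv_smul, FourierTransform.fourier_fourierInv_eq]
  rw [sub_eq_add_neg, ← neg_smul, FourierTransform.fourier_add, FourierTransform.fourier_smul, h]
  simp only [_root_.add_apply, _root_.smul_apply]
  rw [smulLeftCLM_apply_apply (by fun_prop), norm_smul]
  simp only [real_smul, Real.norm_eq_abs, mul_pow, sq_abs]
  push_cast
  ring

/-- Integration against `besselMeasure E s` inverts `1 - s Δ` on Schwartz functions, because its
characteristic function is the reciprocal of the symbol of `1 - s Δ`. -/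
lemma integral_besselMeasure_sub_smul_laplacian_complex {s : ℝ} (hs : 0 < s) (φ : 𝓢(E, ℂ))
    (x : E) : ∫ y, (φ - s • Δ φ) (x - y) ∂(besselMeasure E s) = φ x := by
  have := isProbabilityMeasure_besselMeasure E s
  have inv (φ : 𝓢(E, ℂ)) (x : E) :
      φ x = ∫ ξ, cexp ((2 * Real.pi * inner ℝ ξ x : ℝ) * I) * (𝓕 φ) ξ := by
    conv_lhs => rw [← FourierTransform.fourierInv_fourier_eq (F := 𝓢(E, ℂ)) φ]
    rw [fourierInv_coe, Real.fourierInv_eq']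
    simp [smul_eq_mul]
  set ψ := φ - s • Δ φ with hψ
  calc ∫ y, ψ (x - y) ∂(besselMeasure E s)
      = ∫ y, (∫ ξ, cexp ((2 * Real.pi * inner ℝ ξ (x - y) : ℝ) * I) * (𝓕 ψ) ξ)
          ∂(besselMeasure E s) := by simp_rw [inv ψ]
    _ = ∫ ξ, (∫ y, cexp ((2 * Real.pi * inner ℝ ξ (x - y) : ℝ) * I) * (𝓕 ψ) ξ
          ∂(besselMeasure E s)) := by
        refine integral_integral_swap ?_
        refine ((𝓕 ψ).integrable.comp_snd (besselMeasure E s)).bdd_mul (c := 1)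
          (Continuous.aestronglyMeasurable (by fun_prop)) ?_
        exact Filter.Eventually.of_forall fun z => (Complex.norm_exp_ofReal_mul_I _).le
    _ = ∫ ξ, cexp ((2 * Real.pi * inner ℝ ξ x : ℝ) * I) * (𝓕 φ) ξ := by
        refine integral_congr_ae (Filter.Eventually.of_forall fun ξ => ?_)
        have h1 (y : E) : cexp ((2 * Real.pi * inner ℝ ξ (x - y) : ℝ) * I) * (𝓕 ψ) ξ
            = cexp ((inner ℝ y (-((2 * Real.pi) • ξ)) : ℝ) * I)
              * (cexp ((2 * Real.pi * inner ℝ ξ x : ℝ) * I) * (𝓕 ψ) ξ) := by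
          rw [← mul_assoc, ← Complex.exp_add, inner_sub_right, inner_neg_right,
            real_inner_smul_right, real_inner_comm ξ y]
          congr 2
          push_cast
          ring
        have hne : (1 + s * ‖(2 * Real.pi) • ξ‖ ^ 2 : ℝ) ≠ 0 := by positivity
        simp only [h1]
        rw [integral_mul_const, ← charFun_apply, charFun_besselMeasure E hs, hψ,
          fourier_sub_smul_laplacian, norm_neg, real_smul]
        have hc : ((1 + s * ‖(2 * Real.pi) • ξ‖ ^ 2 : ℝ) : ℂ)
            * ((1 + s * ‖(2 * Real.pi) • ξ‖ ^ 2 : ℝ)⁻¹ : ℝ) = 1 := by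
          rw [← ofReal_mul, mul_inv_cancel₀ hne, ofReal_one]
        linear_combination (cexp ((2 * Real.pi * inner ℝ ξ x : ℝ) * I) * (𝓕 φ) ξ) * hc
    _ = φ x := (inv φ x).symm

lemma integral_besselMeasure_sub_smul_laplacian {s : ℝ} (hs : 0 < s) (φ : 𝓢(E, ℝ)) (x : E) :
    ∫ y, (φ (x - y) - s * (Δ φ) (x - y)) ∂(besselMeasure E s) = φ x := by
  have h := integral_besselMeasure_sub_smul_laplacian_complex hs (φ.postcompCLM ofRealCLM) x
  simp only [_root_.sub_apply, _root_.smul_apply, laplacian_comp_clm,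
    postcompCLM_apply, ofRealCLM_apply, real_smul] at h
  have h' := h
  simp only [← ofReal_mul, ← ofReal_sub] at h'
  rw [integral_complex_ofReal] at h'
  exact_mod_cast h'

/-- `1 - s Δ` maps the Schwartz functions onto themselves: the reciprocal of its symbol has
temperate growth, so it is a Fourier multiplier. -/
lemma exists_sub_smul_laplacian_eq {s : ℝ} (hs : 0 < s) (θ : 𝓢(E, ℝ)) :
    ∃ φ : 𝓢(E, ℝ), ∀ x, φ x - s * (Δ φ) x = θ x := by
  let m : E → ℝ := fun ξ => (1 + s * ‖(2 * Real.pi) • ξ‖ ^ 2)⁻¹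
  have hm : m.HasTemperateGrowth := by
    have h := (Function.hasTemperateGrowth_one_add_norm_sq_rpow E (-1)).comp
      (((√s * (2 * Real.pi)) • ContinuousLinearMap.id ℝ E).hasTemperateGrowth)
    have hmh : m = (fun x : E => (1 + ‖x‖ ^ 2) ^ (-1 : ℝ)) ∘
        ((√s * (2 * Real.pi)) • ContinuousLinearMap.id ℝ E) := by
      ext ξ
      simp [m, Real.rpow_neg_one, norm_smul, mul_pow, Real.sq_sqrt hs.le, mul_assoc]
    rwa [hmh]
  let Θ : 𝓢(E, ℂ) := θ.postcompCLM ofRealCLM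
  let φ : 𝓢(E, ℂ) := 𝓕⁻ (smulLeftCLM ℂ m (𝓕 Θ))
  have hφ : φ - s • Δ φ = Θ := by
    rw [← FourierTransform.fourierInv_fourier_eq (F := 𝓢(E, ℂ)) (φ - s • Δ φ),
      ← FourierTransform.fourierInv_fourier_eq (F := 𝓢(E, ℂ)) Θ]
    refine congrArg _ ?_
    ext ξ
    have hne : (1 + s * ‖(2 * Real.pi) • ξ‖ ^ 2 : ℝ) ≠ 0 := by positivity
    rw [fourier_sub_smul_laplacian, FourierTransform.fourier_fourierInv_eq,
      smulLeftCLM_apply_apply hm, smul_smul, mul_inv_cancel₀ hne, one_smul]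
  refine ⟨φ.postcompCLM reCLM, fun x => ?_⟩
  rw [laplacian_comp_clm, postcompCLM_apply]
  have h := congrArg (fun f : 𝓢(E, ℂ) => (f x).re) hφ
  simpa [Θ] using h

end Schwartz

/-! ### Schwartz test functions for bounded functions with bounded Laplacian -/

section Cutoff

open SchwartzMap Filter Topology

variable {E : Type*} [NormedAddCommGroup E] [InnerProductSpace ℝ E] [FiniteDimensional ℝ E]

lemma abs_laplacian_le (f : E → ℝ) (x : E) :
    |(Δ f) x| ≤ Module.finrank ℝ E * ‖iteratedFDeriv ℝ 2 f x‖ := by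
  rw [InnerProductSpace.laplacian_eq_iteratedFDeriv_stdOrthonormalBasis]
  refine (Finset.abs_sum_le_sum_abs _ _).trans ?_
  refine (Finset.sum_le_card_nsmul _ _ ‖iteratedFDeriv ℝ 2 f x‖ fun i _ => ?_).trans (by simp)
  refine ((iteratedFDeriv ℝ 2 f x).le_opNorm _).trans ?_
  simp [Fin.prod_univ_two]

variable (E) in
/-- Smooth cutoffs, eventually equal to `1` near each point, with uniformly bounded derivatives:
dilations `x ↦ χ (x / (n + 1))` of a fixed bump function. -/
lemma exists_cutoff : ∃ (χ : ℕ → E → ℝ) (C : ℝ), (∀ n, ContDiff ℝ ∞ (χ n)) ∧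
    (∀ n, HasCompactSupport (χ n)) ∧ (∀ x, ∀ᶠ n in atTop, χ n =ᶠ[𝓝 x] fun _ => 1) ∧
    ∀ n, ∀ i ≤ 2, ∀ x, ‖iteratedFDeriv ℝ i (χ n) x‖ ≤ C := by
  let η : ContDiffBump (0 : E) := ⟨1, 2, one_pos, one_lt_two⟩
  have hη : ContDiff ℝ ∞ η := η.contDiff
  have hbd (i : ℕ) : ∃ C, ∀ x, ‖iteratedFDeriv ℝ i η x‖ ≤ C := by
    refine (Continuous.bounded_above_of_compact_support ?_ (η.hasCompactSupport.iteratedFDeriv i))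
    exact hη.continuous_iteratedFDeriv (mod_cast le_top)
  choose B hB using hbd
  have hB0 (i : ℕ) : 0 ≤ B i := (norm_nonneg _).trans (hB i 0)
  let c : ℕ → ℝ := fun n => ((n : ℝ) + 1)⁻¹
  have hc (n : ℕ) : 0 < c n := by positivity
  have hc1 (n : ℕ) : c n ≤ 1 := inv_le_one_of_one_le₀ (by linarith [n.cast_nonneg (α := ℝ)])
  refine ⟨fun n x => η (c n • x), B 0 + B 1 + B 2, fun n => hη.comp (contDiff_const_smul _),
    fun n => ?_, fun x => ?_, fun n i hi x => ?_⟩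
  · exact η.hasCompactSupport.comp_smul (hc n).ne'
  · obtain ⟨N, hN⟩ := exists_nat_gt ‖x‖
    filter_upwards [eventually_ge_atTop N] with n hn
    have hx : c n • x ∈ Metric.ball (0 : E) 1 := by
      have : (N : ℝ) ≤ n := by exact_mod_cast hn
      rw [mem_ball_zero_iff, norm_smul, Real.norm_of_nonneg (hc n).le,
        inv_mul_lt_iff₀ (by positivity)]
      linarith
    have h1 : ∀ᶠ y in 𝓝 x, c n • y ∈ Metric.ball (0 : E) 1 :=
      (continuous_const_smul (c n)).continuousAt.eventually (Metric.isOpen_ball.mem_nhds hx)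
    filter_upwards [h1] with y hy
    exact η.one_of_mem_closedBall (Metric.ball_subset_closedBall hy)
  · rw [iteratedFDeriv_comp_const_smul _ (hη.of_le (mod_cast le_top)), norm_smul, norm_pow,
      Real.norm_of_nonneg (hc n).le]
    have h1 : c n ^ i * ‖iteratedFDeriv ℝ i η (c n • x)‖ ≤ 1 * B i :=
      mul_le_mul (pow_le_one₀ (hc n).le (hc1 n)) (hB _ _) (norm_nonneg _) zero_le_one
    have h2 : B i ≤ B 0 + B 1 + B 2 := by
      interval_cases i <;> linarith [hB0 0, hB0 1, hB0 2]
    linarith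

/-- For bounded `w` and `g`, the weak Laplacian may be tested against Schwartz functions `φ`:
cut `φ` off and pass to the limit. The derivatives of the cutoffs are bounded and those of `φ` are
integrable, so dominated convergence applies. -/
lemma HasWeakLaplacian.integral_schwartz {d : ℕ} {w g : EuclideanSpace ℝ (Fin d) → ℝ}
    (h : HasWeakLaplacian w g) (hw : MemLp w ∞ volume) (hg : MemLp g ∞ volume)
    (φ : 𝓢(EuclideanSpace ℝ (Fin d), ℝ)) :
    ∫ x, w x * (Δ φ) x = ∫ x, g x * φ x := by
  obtain ⟨χ, C, hχ, hχc, hχ1, hχC⟩ := exists_cutoff (EuclideanSpace ℝ (Fin d))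
  obtain ⟨W, hW0, hW⟩ := hw.exists_ae_abs_le
  obtain ⟨K, hK0, hK⟩ := hg.exists_ae_abs_le
  have hle (i : ℕ) : (i : ℕ∞ω) ≤ (∞ : ℕ∞ω) := mod_cast le_top
  let ψ : ℕ → EuclideanSpace ℝ (Fin d) → ℝ := fun n x => χ n x * φ x
  have hψ (n : ℕ) : ContDiff ℝ ∞ (ψ n) := (hχ n).mul (φ.smooth ⊤)
  have hψc (n : ℕ) : HasCompactSupport (ψ n) := (hχc n).mul_right
  have heq (n : ℕ) : ∫ x, w x * (Δ (ψ n)) x = ∫ x, g x * ψ n x := h.2.2 _ (hψ n) (hψc n)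
  have hC0 : 0 ≤ C := (norm_nonneg _).trans (hχC 0 0 (by norm_num) 0)
  have hev (x : EuclideanSpace ℝ (Fin d)) : ∀ᶠ n in atTop, ψ n =ᶠ[𝓝 x] φ := by
    filter_upwards [hχ1 x] with n hn
    filter_upwards [hn] with y hy
    simp [ψ, hy]
  let D : ℕ → EuclideanSpace ℝ (Fin d) → ℝ := fun i x => ‖iteratedFDeriv ℝ i φ x‖
  have hD (i : ℕ) : Integrable (D i) := by
    simpa using φ.integrable_pow_mul_iteratedFDeriv volume 0 i
  have hlap (n : ℕ) (x : EuclideanSpace ℝ (Fin d)) :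
      |(Δ (ψ n)) x| ≤ d * (C * D 2 x + 2 * C * D 1 x + C * D 0 x) := by
    refine (abs_laplacian_le (ψ n) x).trans ?_
    rw [finrank_euclideanSpace_fin]
    gcongr
    have hsum (F : ℕ → ℝ) : ∑ i ∈ Finset.range (2 + 1), (Nat.choose 2 i : ℝ) * C * F (2 - i)
        = C * F 2 + 2 * C * F 1 + C * F 0 := by
      simp [Finset.sum_range_succ]
    rw [← hsum (fun i => D i x)]
    refine (norm_iteratedFDeriv_mul_le (hχ n) (φ.smooth ⊤) x (n := 2)
      (hle 2)).trans (Finset.sum_le_sum fun i hi => ?_)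
    have := hχC n i (by simpa [Nat.lt_succ_iff] using hi) x
    simp only [D]
    gcongr
  have hl : Tendsto (fun n => ∫ x, w x * (Δ (ψ n)) x) atTop (𝓝 (∫ x, w x * (Δ φ) x)) := by
    refine tendsto_integral_of_dominated_convergence
      (fun x => W * (d * (C * D 2 x + 2 * C * D 1 x + C * D 0 x))) (fun n => ?_) ?_ (fun n => ?_) ?_
    · refine hw.1.mul (Continuous.aestronglyMeasurable ?_)
      rw [InnerProductSpace.laplacian_eq_iteratedFDeriv_stdOrthonormalBasis]
      have := (hψ n).continuous_iteratedFDeriv (m := 2)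
        (hle 2)
      fun_prop
    · exact (((((hD 2).const_mul _).add ((hD 1).const_mul _)).add
        ((hD 0).const_mul _)).const_mul _).const_mul _
    · filter_upwards [hW] with x hx
      rw [Real.norm_eq_abs, abs_mul]
      exact mul_le_mul hx (hlap n x) (abs_nonneg _) hW0
    · refine Eventually.of_forall fun x => tendsto_const_nhds.congr' ?_
      filter_upwards [hev x] with n hn
      rw [laplacian_apply, (InnerProductSpace.laplacian_congr_nhds hn).eq_of_nhds]
  have hr : Tendsto (fun n => ∫ x, g x * ψ n x) atTop (𝓝 (∫ x, g x * φ x)) := by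
    refine tendsto_integral_of_dominated_convergence (fun x => K * (C * D 0 x)) (fun n => ?_)
      (((hD 0).const_mul _).const_mul _) (fun n => ?_) ?_
    · exact hg.1.mul (hψ n).continuous.aestronglyMeasurable
    · filter_upwards [hK] with x hx
      rw [Real.norm_eq_abs, abs_mul, abs_mul]
      have h0 := hχC n 0 (by norm_num) x
      simp only [norm_iteratedFDeriv_zero, Real.norm_eq_abs] at h0
      simp only [D, norm_iteratedFDeriv_zero, Real.norm_eq_abs]
      gcongr
    · refine Eventually.of_forall fun x => tendsto_const_nhds.congr' ?_
      filter_upwards [hev x] with n hn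
      rw [hn.eq_of_nhds]
  simp only [heq] at hl
  exact tendsto_nhds_unique hl hr

end Cutoff

/-! ### The elliptic equation as a fixed-point problem -/

section Elliptic

open SchwartzMap Filter Topology

variable {d : ℕ} {w w' f f' g g' a b h : EuclideanSpace ℝ (Fin d) → ℝ} {s κ A : ℝ}

lemma MeasureTheory.MemLp.locallyIntegrable_top (hf : MemLp f ∞ volume) : LocallyIntegrable f :=
  hf.locallyIntegrable le_top

lemma HasWeakLaplacian.congr (h : HasWeakLaplacian w g) (hw : w =ᵐ[volume] w')
    (hg : g =ᵐ[volume] g') : HasWeakLaplacian w' g' := by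
  refine ⟨fun x => (h.1 x).congr hw, fun x => (h.2.1 x).congr hg, fun φ hφ hc => ?_⟩
  have h1 : ∫ x, w x * (Δ φ) x = ∫ x, w' x * (Δ φ) x :=
    integral_congr_ae (hw.mul (EventuallyEq.refl _ (Δ φ)))
  have h2 : ∫ x, g x * φ x = ∫ x, g' x * φ x :=
    integral_congr_ae (hg.mul (EventuallyEq.refl _ φ))
  rw [← h1, ← h2]
  exact h.2.2 φ hφ hc

/-- A bounded function with bounded Laplacian is recovered from `w - s Δ w` by averaging over
`besselMeasure`: dually, `1 - s Δ` is onto the Schwartz functions. -/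
lemma HasWeakLaplacian.ae_eq_translationAverage (hs : 0 < s) (h : HasWeakLaplacian w g)
    (hw : MemLp w ∞ volume) (hg : MemLp g ∞ volume) :
    w =ᵐ[volume] translationAverage (besselMeasure _ s) (fun x => w x - s * g x) := by
  have := isProbabilityMeasure_besselMeasure (EuclideanSpace ℝ (Fin d)) s
  have hh : MemLp (fun x => w x - s * g x) ∞ volume := hw.sub (hg.const_mul s)
  refine ae_eq_of_integral_contDiff_smul_eq h.1 (memLp_translationAverage hh).locallyIntegrable_top
    fun ψ hψ hψc => ?_
  obtain ⟨φ, hφ⟩ := exists_sub_smul_laplacian_eq hs (hψc.toSchwartzMap hψ)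
  replace hφ : ∀ x, φ x - s * (Δ φ) x = ψ x := hφ
  have hint {u : EuclideanSpace ℝ (Fin d) → ℝ} (hu : MemLp u ∞ volume)
      (θ : 𝓢(EuclideanSpace ℝ (Fin d), ℝ)) : Integrable (fun x => u x * θ x) := by
    obtain ⟨C, -, hC⟩ := hu.exists_ae_abs_le
    exact θ.integrable.bdd_mul hu.1 hC
  calc ∫ x, ψ x • w x
      = ∫ x, (w x * φ x - s * (w x * (Δ φ) x)) := by
        refine integral_congr_ae (.of_forall fun x => ?_)
        simp only [smul_eq_mul, ← hφ x]
        ring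
    _ = ∫ x, (w x * φ x - s * (g x * φ x)) := by
        rw [integral_sub (hint hw φ) ((hint hw (Δ φ)).const_mul s),
          integral_sub (hint hw φ) ((hint hg φ).const_mul s), integral_const_mul,
          integral_const_mul, h.integral_schwartz hw hg]
    _ = ∫ x, (w x - s * g x) * ∫ y, ψ (x - y) ∂(besselMeasure _ s) := by
        refine integral_congr_ae (.of_forall fun x => ?_)
        simp only [← hφ, integral_besselMeasure_sub_smul_laplacian hs φ]
        ring
    _ = ∫ x, translationAverage (besselMeasure _ s) (fun x => w x - s * g x) x * ψ x :=
        (integral_translationAverage_mul hh (hψ.continuous.integrable_of_hasCompactSupport hψc)).symm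
    _ = _ := by simp_rw [smul_eq_mul, mul_comm]

/-- Averaging a bounded `f` over `besselMeasure` solves `w - s Δ w = f`: dually, the average of
`ψ - s Δ ψ` is `ψ` for a test function `ψ`. -/
lemma hasWeakLaplacian_translationAverage (hs : 0 < s) (hf : MemLp f ∞ volume) :
    HasWeakLaplacian (translationAverage (besselMeasure _ s) f)
      (fun x => s⁻¹ * (translationAverage (besselMeasure _ s) f x - f x)) := by
  have := isProbabilityMeasure_besselMeasure (EuclideanSpace ℝ (Fin d)) s
  have hR : MemLp (translationAverage (besselMeasure _ s) f) ∞ volume := memLp_translationAverage hf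
  refine ⟨hR.locallyIntegrable_top, ((hR.sub hf).const_mul s⁻¹).locallyIntegrable_top,
    fun ψ hψ hψc => ?_⟩
  let φ : 𝓢(EuclideanSpace ℝ (Fin d), ℝ) := hψc.toSchwartzMap hψ
  have hφ : ∀ x, φ x = ψ x := fun _ => rfl
  have hφΔ : ∀ x, (Δ φ) x = (Δ ψ) x := fun x => laplacian_apply φ x
  have hint {u : EuclideanSpace ℝ (Fin d) → ℝ} (hu : MemLp u ∞ volume)
      (θ : 𝓢(EuclideanSpace ℝ (Fin d), ℝ)) : Integrable (fun x => u x * θ x) := by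
    obtain ⟨C, -, hC⟩ := hu.exists_ae_abs_le
    exact θ.integrable.bdd_mul hu.1 hC
  have key := integral_translationAverage_mul (γ := besselMeasure _ s) hf
    (φ.integrable.sub ((Δ φ).integrable.const_mul s))
  simp only [Pi.sub_apply, integral_besselMeasure_sub_smul_laplacian hs φ] at key
  simp only [mul_sub, ← hφ, ← hφΔ]
  simp only [mul_sub, mul_left_comm _ s] at key
  rw [integral_sub (hint hR φ) ((hint hR (Δ φ)).const_mul s), integral_const_mul] at key
  simp only [sub_mul, mul_assoc]
  rw [integral_sub ((hint hR φ).const_mul _) ((hint hf φ).const_mul _), integral_const_mul,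
    integral_const_mul, ← key]
  field_simp
  ring

/-- The right-hand side of the fixed-point form `w = (1 - (κ/A) Δ)⁻¹ (f/A + (1 - a/A) w)` of the
equation `a w - κ Δ w = f`. For `A` an upper bound of `a ≥ 1`, the coefficient of `w` lies in
`[0, 1 - 1/A]`. -/
noncomputable def ellipticSource (a : EuclideanSpace ℝ (Fin d) → ℝ) (A : ℝ)
    (f w : EuclideanSpace ℝ (Fin d) → ℝ) (x : EuclideanSpace ℝ (Fin d)) : ℝ :=
  f x / A + (1 - a x / A) * w x

lemma memLp_one_sub_div (ha : MemLp a ∞ volume) : MemLp (fun x => 1 - a x / A) ∞ volume := by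
  simp only [div_eq_inv_mul]
  exact (memLp_top_const (1 : ℝ)).sub (ha.const_mul A⁻¹)

lemma memLp_ellipticSource (ha : MemLp a ∞ volume) (hf : MemLp f ∞ volume)
    (hw : MemLp w ∞ volume) : MemLp (ellipticSource a A f w) ∞ volume := by
  have h1 : MemLp (fun x => f x / A) ∞ volume := by
    simpa [div_eq_inv_mul] using hf.const_mul A⁻¹
  exact h1.add ((memLp_one_sub_div ha).mul_top hw)

lemma solvesElliptic_iff (hκ : 0 < κ) (hA : 0 < A) (ha : MemLp a ∞ volume)
    (hf : MemLp f ∞ volume) :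
    SolvesElliptic a κ w f ↔ MemLp w ∞ volume ∧
      w =ᵐ[volume] translationAverage (besselMeasure _ (κ / A)) (ellipticSource a A f w) := by
  constructor
  · rintro ⟨hw, g, hg, heq⟩
    refine ⟨hw, ?_⟩
    -- the equation itself shows that the Laplacian is bounded
    have hg' : g =ᵐ[volume] fun x => κ⁻¹ * (a x * w x - f x) := by
      filter_upwards [heq] with x hx
      rw [← hx]
      field_simp
      ring
    have h := (hg.congr .rfl hg').ae_eq_translationAverage (div_pos hκ hA) hw
      (((ha.mul_top hw).sub hf).const_mul κ⁻¹)
    convert h using 3 with x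
    simp only [ellipticSource]
    field_simp
    ring
  · rintro ⟨hw, heq⟩
    refine ⟨hw, fun x => κ⁻¹ * (a x * w x - f x), ?_, .of_forall fun x => ?_⟩
    · refine (hasWeakLaplacian_translationAverage (div_pos hκ hA)
        (memLp_ellipticSource (A := A) ha hf hw)).congr heq.symm ?_
      filter_upwards [heq] with x hx
      rw [← hx, ellipticSource]
      field_simp
      ring
    · field_simp
      ring

lemma SolvesElliptic.congr (h : SolvesElliptic a κ w f) {a' : EuclideanSpace ℝ (Fin d) → ℝ}
    (ha : a =ᵐ[volume] a') (hf : f =ᵐ[volume] f') : SolvesElliptic a' κ w f' := by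
  obtain ⟨hw, g, hg, heq⟩ := h
  refine ⟨hw, g, hg, ?_⟩
  filter_upwards [heq, ha, hf] with x hx h1 h2
  rw [← h1, ← h2, hx]

/-- A bounded `w ≥ R (b w)` with `0 ≤ b ≤ q < 1` and `R` an average is nonnegative: a lower bound
`-C` improves to `-(q C)`, and so on to `0`. -/
lemma ae_nonneg_of_translationAverage_le {γ : Measure (EuclideanSpace ℝ (Fin d))}
    [IsProbabilityMeasure γ] {q : ℝ} (hq0 : 0 ≤ q) (hq : q < 1) (hw : MemLp w ∞ volume)
    (hb : MemLp b ∞ volume) (hbq : ∀ᵐ x, 0 ≤ b x ∧ b x ≤ q)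
    (h : ∀ᵐ x, translationAverage γ (fun x => b x * w x) x ≤ w x) : ∀ᵐ x, 0 ≤ w x := by
  obtain ⟨C, hC0, hC⟩ := hw.exists_ae_abs_le
  have step (n : ℕ) : ∀ᵐ x, -(q ^ n * C) ≤ w x := by
    induction n with
    | zero => filter_upwards [hC] with x hx; simpa using neg_le_of_abs_le hx
    | succ n ih =>
      have hle : ∀ᵐ x, -(q ^ (n + 1) * C) ≤ b x * w x := by
        filter_upwards [ih, hbq] with x hx hbx
        have h1 : b x * -(q ^ n * C) ≤ b x * w x := mul_le_mul_of_nonneg_left hx hbx.1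
        have h2 : b x * (q ^ n * C) ≤ q * (q ^ n * C) :=
          mul_le_mul_of_nonneg_right hbx.2 (by positivity)
        rw [pow_succ]
        linarith
      filter_upwards [h, translationAverage_mono (γ := γ) (memLp_top_const _) (hb.mul_top hw) hle]
        with x hx h2
      refine le_trans ?_ (h2.trans hx)
      simp [translationAverage]
  filter_upwards [ae_all_iff.2 step] with x hx
  have hlim : Tendsto (fun n : ℕ => -(q ^ n * C)) atTop (𝓝 0) := by
    simpa using ((tendsto_pow_atTop_nhds_zero_of_lt_one hq0 hq).mul_const C).neg
  exact le_of_tendsto' hlim hx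

lemma exists_one_le_ae_le (ha : MemLp a ∞ volume) : ∃ A, 1 ≤ A ∧ ∀ᵐ x, a x ≤ A := by
  obtain ⟨C, -, hC⟩ := ha.exists_ae_abs_le
  refine ⟨max 1 C, le_max_left _ _, ?_⟩
  filter_upwards [hC] with x hx
  exact (le_abs_self _).trans (hx.trans (le_max_right _ _))

lemma one_sub_div_mem {t : ℝ} (hA : 1 ≤ A) (h1 : 1 ≤ t) (h2 : t ≤ A) :
    0 ≤ 1 - t / A ∧ 1 - t / A ≤ 1 - 1 / A := by
  have hA' : 0 < A := by linarith
  refine ⟨sub_nonneg.2 ((div_le_one hA').2 h2), ?_⟩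
  gcongr

/-- Comparison principle: the difference of two solutions satisfies `w' - w ≥ R (b (w' - w))` with
`b = 1 - a/A`, because `R` is monotone. -/
lemma SolvesElliptic.ae_le (hκ : 0 < κ) (ha : MemLp a ∞ volume) (ha1 : ∀ᵐ x, 1 ≤ a x)
    (hf : MemLp f ∞ volume) (hf' : MemLp f' ∞ volume) (h : SolvesElliptic a κ w f)
    (h' : SolvesElliptic a κ w' f') (hle : ∀ᵐ x, f x ≤ f' x) : ∀ᵐ x, w x ≤ w' x := by
  obtain ⟨A, hA, haA⟩ := exists_one_le_ae_le ha
  have hA0 : 0 < A := by linarith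
  obtain ⟨hw, heq⟩ := (solvesElliptic_iff hκ hA0 ha hf).1 h
  obtain ⟨hw', heq'⟩ := (solvesElliptic_iff hκ hA0 ha hf').1 h'
  have := isProbabilityMeasure_besselMeasure (EuclideanSpace ℝ (Fin d)) (κ / A)
  have hb : MemLp (fun x => 1 - a x / A) ∞ volume := memLp_one_sub_div ha
  have hS := memLp_ellipticSource (A := A) ha hf hw
  have hS' := memLp_ellipticSource (A := A) ha hf' hw'
  have hbq : ∀ᵐ x, 0 ≤ 1 - a x / A ∧ 1 - a x / A ≤ 1 - 1 / A := by
    filter_upwards [ha1, haA] with x h1 h2 using one_sub_div_mem hA h1 h2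
  have hdiff : ∀ᵐ x, 0 ≤ w' x - w x := by
    refine ae_nonneg_of_translationAverage_le (γ := besselMeasure _ (κ / A)) (q := 1 - 1 / A)
      (sub_nonneg.2 ((div_le_one hA0).2 hA)) (sub_lt_self _ (by positivity)) (hw'.sub hw) hb hbq ?_
    have hle' : ∀ᵐ x, (1 - a x / A) * (w' x - w x)
        ≤ ellipticSource a A f' w' x - ellipticSource a A f w x := by
      filter_upwards [hle] with x hx
      have : f x / A ≤ f' x / A := by gcongr
      simp only [ellipticSource]
      linarith
    filter_upwards [heq, heq', translationAverage_sub (γ := besselMeasure _ (κ / A)) hS' hS,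
      translationAverage_mono (γ := besselMeasure _ (κ / A)) (hb.mul_top (hw'.sub hw))
        (hS'.sub hS) hle'] with x h1 h2 h3 h4
    rw [h1, h2, ← h3]
    exact h4
  filter_upwards [hdiff] with x hx using sub_nonneg.1 hx

lemma solvesElliptic_const (M : ℝ) : SolvesElliptic a κ (fun _ => M) (fun x => a x * M) := by
  refine ⟨memLp_top_const M, 0, ?_, .of_forall fun x => by simp⟩
  have h := hasWeakLaplacian_translationAverage (d := d) one_pos (f := fun _ => M)
    (memLp_top_const M)
  have := isProbabilityMeasure_besselMeasure (EuclideanSpace ℝ (Fin d)) 1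
  exact h.congr (.of_forall fun x => by simp [translationAverage])
    (.of_forall fun x => by simp [translationAverage])

lemma SolvesElliptic.ae_nonneg (hκ : 0 < κ) (ha : MemLp a ∞ volume) (ha1 : ∀ᵐ x, 1 ≤ a x)
    (hf : MemLp f ∞ volume) (h : SolvesElliptic a κ w f) (h0 : ∀ᵐ x, 0 ≤ f x) :
    ∀ᵐ x, 0 ≤ w x :=
  (solvesElliptic_const 0).ae_le hκ ha ha1 (ha.mul_top (memLp_top_const 0)) hf h
    (by simpa using h0)

lemma SolvesElliptic.ae_le_const (hκ : 0 < κ) (ha : MemLp a ∞ volume) (ha1 : ∀ᵐ x, 1 ≤ a x)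
    (hf : MemLp f ∞ volume) (h : SolvesElliptic a κ w f) {M : ℝ} (hM : 0 ≤ M)
    (hfM : ∀ᵐ x, f x ≤ M) : ∀ᵐ x, w x ≤ M := by
  refine h.ae_le hκ ha ha1 hf (ha.mul_top (memLp_top_const M)) (solvesElliptic_const M) ?_
  filter_upwards [ha1, hfM] with x h1 h2
  exact h2.trans (le_mul_of_one_le_left hM h1)

lemma SolvesElliptic.const_le_ae (hκ : 0 < κ) (ha : MemLp a ∞ volume) (ha1 : ∀ᵐ x, 1 ≤ a x)
    (hf : MemLp f ∞ volume) (h : SolvesElliptic a κ w f) {M : ℝ} (hM : M ≤ 0)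
    (hfM : ∀ᵐ x, M ≤ f x) : ∀ᵐ x, M ≤ w x := by
  refine (solvesElliptic_const M).ae_le hκ ha ha1 (ha.mul_top (memLp_top_const M)) hf h ?_
  filter_upwards [ha1, hfM] with x h1 h2
  exact (mul_le_of_one_le_left hM h1).trans h2

lemma SolvesElliptic.ae_eq (hκ : 0 < κ) (ha : MemLp a ∞ volume) (ha1 : ∀ᵐ x, 1 ≤ a x)
    (hf : MemLp f ∞ volume) (h : SolvesElliptic a κ w f) (h' : SolvesElliptic a κ w' f) :
    w =ᵐ[volume] w' := by
  filter_upwards [h.ae_le hκ ha ha1 hf hf h' (.of_forall fun _ => le_rfl),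
    h'.ae_le hκ ha ha1 hf hf h (.of_forall fun _ => le_rfl)] with x h1 h2 using le_antisymm h1 h2

/-- Existence, by Banach's fixed-point theorem in `L^∞`. -/
lemma exists_solvesElliptic (hκ : 0 < κ) (ha : MemLp a ∞ volume) (ha1 : ∀ᵐ x, 1 ≤ a x)
    (hf : MemLp f ∞ volume) : ∃ w, SolvesElliptic a κ w f := by
  obtain ⟨A, hA, haA⟩ := exists_one_le_ae_le ha
  have hA0 : 0 < A := by linarith
  have := isProbabilityMeasure_besselMeasure (EuclideanSpace ℝ (Fin d)) (κ / A)
  have hT (w : Lp ℝ ∞ (volume : Measure (EuclideanSpace ℝ (Fin d)))) :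
      MemLp (translationAverage (besselMeasure _ (κ / A)) (ellipticSource a A f w)) ∞ volume :=
    memLp_translationAverage (memLp_ellipticSource ha hf (Lp.memLp w))
  let T (w : Lp ℝ ∞ (volume : Measure (EuclideanSpace ℝ (Fin d)))) :
      Lp ℝ ∞ (volume : Measure (EuclideanSpace ℝ (Fin d))) := (hT w).toLp
  have hq0 : 0 ≤ 1 - 1 / A := sub_nonneg.2 ((div_le_one hA0).2 hA)
  have hcontr : ContractingWith (1 - 1 / A).toNNReal T := by
    refine ⟨Real.toNNReal_lt_one.2 (sub_lt_self _ (by positivity)),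
      LipschitzWith.of_dist_le_mul fun w w' => ?_⟩
    rw [dist_eq_norm, dist_eq_norm, Lp.norm_def (T w - T w'), Real.coe_toNNReal _ hq0]
    refine toReal_eLpNorm_top_le (mul_nonneg hq0 (norm_nonneg _)) ?_
    have hww : ∀ᵐ x, |ellipticSource a A f w x - ellipticSource a A f w' x|
        ≤ (1 - 1 / A) * ‖w - w'‖ := by
      have hn : ∀ᵐ x, |(w - w' : Lp ℝ ∞ _) x| ≤ ‖w - w'‖ := (Lp.memLp (w - w')).ae_abs_le
      filter_upwards [hn, Lp.coeFn_sub w w', ha1, haA] with x hx hsub h1 h2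
      obtain ⟨hb0, hb1⟩ := one_sub_div_mem hA h1 h2
      rw [hsub, Pi.sub_apply] at hx
      have : ellipticSource a A f w x - ellipticSource a A f w' x
          = (1 - a x / A) * (w x - w' x) := by
        simp only [ellipticSource]; ring
      rw [this, abs_mul, abs_of_nonneg hb0]
      exact mul_le_mul hb1 hx (abs_nonneg _) hq0
    filter_upwards [Lp.coeFn_sub (T w) (T w'), (hT w).coeFn_toLp, (hT w').coeFn_toLp,
      translationAverage_sub (γ := besselMeasure _ (κ / A))
        (memLp_ellipticSource (A := A) ha hf (Lp.memLp w))
        (memLp_ellipticSource (A := A) ha hf (Lp.memLp w')),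
      ae_abs_translationAverage_le (γ := besselMeasure _ (κ / A)) hww] with x h1 h2 h3 h4 h5
    rw [h1, Pi.sub_apply, h2, h3, ← h4]
    exact h5
  let w := hcontr.fixedPoint T
  refine ⟨w, (solvesElliptic_iff hκ hA0 ha hf).2 ⟨Lp.memLp w, ?_⟩⟩
  have hfix : T w = w := hcontr.fixedPoint_isFixedPt
  have h := (hT w).coeFn_toLp
  change ⇑(T w) =ᵐ[volume] _ at h
  rwa [hfix] at h

end Elliptic

/-! ### The semi-implicit scheme -/

section Scheme

open Filter

variable {d : ℕ} {ε τ lam d₁ d₂ D U V : ℝ} {u v p u' v' p' c w f : EuclideanSpace ℝ (Fin d) → ℝ}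

lemma memLp_one_add_mul (k : ℝ) (hc : MemLp c ∞ volume) :
    MemLp (fun x => 1 + k * c x) ∞ volume :=
  (memLp_top_const (1 : ℝ)).add (hc.const_mul k)

lemma ae_one_le_one_add_mul {k : ℝ} (hk : 0 ≤ k) (hc : ∀ᵐ x, 0 ≤ c x) :
    ∀ᵐ x, 1 ≤ 1 + k * c x := by
  filter_upwards [hc] with x hx
  linarith [mul_nonneg hk hx]

/-- The equations for `u` and `v` in the scheme, multiplied by `τ`, are elliptic equations with
absorption coefficient `c` and the old value `f` on the right. -/
lemma solvesElliptic_iff_step (hτ : 0 < τ) (hw : MemLp w ∞ volume) :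
    SolvesElliptic (fun x => 1 + τ / ε * c x) (D * τ) w f ↔ ∃ g, HasWeakLaplacian w g ∧
      ∀ᵐ x, (w x - f x) / τ - D * g x = -(1 / ε) * w x * c x := by
  have key (W F G c : ℝ) : (1 + τ / ε * c) * W - D * τ * G = F ↔
      (W - F) / τ - D * G = -(1 / ε) * W * c := by
    have h : (W - F) / τ - D * G - -(1 / ε) * W * c
        = ((1 + τ / ε * c) * W - D * τ * G - F) / τ := by
      field_simp
      ring
    rw [← sub_eq_zero, ← sub_eq_zero (b := -(1 / ε) * W * c), h, div_eq_zero_iff]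
    simp [hτ.ne']
  simp only [SolvesElliptic, key, hw, true_and]

/-- The implicit equation for the new value `p'` of `p`, solved for `p'`. -/
lemma step_p_iff (hε : 0 < ε) (hτ : 0 < τ) {u v p p' : ℝ} (hu : 0 ≤ u) (hv : 0 ≤ v) :
    (p' - p) / τ = 1 / ε * ((1 - p') * u - v * p') ↔
      p' = (p + τ / ε * u) / (1 + τ / ε * (u + v)) := by
  have h : 0 < 1 + τ / ε * (u + v) := by positivity
  rw [eq_div_iff h.ne', div_eq_iff hτ.ne', ← sub_eq_zero, ← sub_eq_zero (b := p + τ / ε * u)]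
  refine Eq.congr ?_ rfl
  field_simp
  ring

/-- The new value of `p` is the convex combination of `p`, `1` and `0` with weights proportional to
`1`, `(τ/ε) u` and `(τ/ε) v`. -/
lemma step_p_mem (hε : 0 < ε) (hτ : 0 < τ) {u v p : ℝ} (hu : 0 ≤ u) (hv : 0 ≤ v) (hp : 0 ≤ p)
    (hp1 : p ≤ 1) : 0 ≤ (p + τ / ε * u) / (1 + τ / ε * (u + v)) ∧
      (p + τ / ε * u) / (1 + τ / ε * (u + v)) ≤ 1 := by
  have h : 0 < 1 + τ / ε * (u + v) := by positivity
  refine ⟨by positivity, (div_le_one h).2 ?_⟩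
  have : 0 ≤ τ / ε * v := by positivity
  linarith

/-- States `(u, v, p)` the scheme can be continued from: bounded, measurable and within bounds. -/
structure IsAdmissible (U V : ℝ) (u v p : EuclideanSpace ℝ (Fin d) → ℝ) : Prop where
  memLp_u : MemLp u ∞ volume
  memLp_v : MemLp v ∞ volume
  aestronglyMeasurable_p : AEStronglyMeasurable p volume
  bounds : WithinBounds U V u v p

/-- One step of the scheme, from `(u, v, p)` to `(u', v', p')`. -/
structure IsSchemeStep (ε τ lam d₁ d₂ : ℝ) (u v p u' v' p' : EuclideanSpace ℝ (Fin d) → ℝ) :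
    Prop where
  memLp_u : MemLp u' ∞ volume
  memLp_v : MemLp v' ∞ volume
  eq_p : ∀ᵐ x, (p' x - p x) / τ = 1 / ε * ((1 - p' x) * u x - v x * p' x)
  eq_u : ∃ g, HasWeakLaplacian u' g ∧
    ∀ᵐ x, (u' x - u x) / τ - d₁ * g x = -(1 / ε) * u' x * (v x + lam * (1 - p' x))
  eq_v : ∃ g, HasWeakLaplacian v' g ∧
    ∀ᵐ x, (v' x - v x) / τ - d₂ * g x = -(1 / ε) * v' x * (u' x + lam * p' x)

lemma IsSemiImplicitSolution.isSchemeStep {u0 v0 p0 : EuclideanSpace ℝ (Fin d) → ℝ}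
    {u v p : ℕ → EuclideanSpace ℝ (Fin d) → ℝ}
    (h : IsSemiImplicitSolution ε τ lam d₁ d₂ u0 v0 p0 u v p) (n : ℕ) :
    IsSchemeStep ε τ lam d₁ d₂ (u n) (v n) (p n) (u (n + 1)) (v (n + 1)) (p (n + 1)) :=
  ⟨h.memLp_u _, h.memLp_v _, h.step_p n, h.step_u n, h.step_v n⟩

namespace IsAdmissible

lemma congr (h : IsAdmissible U V u v p) (hu : u =ᵐ[volume] u') (hv : v =ᵐ[volume] v')
    (hp : p =ᵐ[volume] p') : IsAdmissible U V u' v' p' := by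
  refine ⟨h.memLp_u.ae_eq hu, h.memLp_v.ae_eq hv, h.aestronglyMeasurable_p.congr hp, ?_⟩
  filter_upwards [h.bounds, hu, hv, hp] with x hx h1 h2 h3
  rwa [← h1, ← h2, ← h3]

/-- The explicit value of the next `p`. -/
lemma ae_p_eq_iff (hε : 0 < ε) (hτ : 0 < τ) (h : IsAdmissible U V u v p) :
    (∀ᵐ x, (p' x - p x) / τ = 1 / ε * ((1 - p' x) * u x - v x * p' x)) ↔
      p' =ᵐ[volume] fun x => (p x + τ / ε * u x) / (1 + τ / ε * (u x + v x)) := by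
  refine eventually_congr ?_
  filter_upwards [h.bounds] with x hx using step_p_iff hε hτ hx.1.1 hx.2.1.1

lemma next_p (hε : 0 < ε) (hτ : 0 < τ) (h : IsAdmissible U V u v p)
    (hp' : p' =ᵐ[volume] fun x => (p x + τ / ε * u x) / (1 + τ / ε * (u x + v x))) :
    MemLp p' ∞ volume ∧ ∀ᵐ x, 0 ≤ p' x ∧ p' x ≤ 1 := by
  have hb : ∀ᵐ x, 0 ≤ p' x ∧ p' x ≤ 1 := by
    filter_upwards [h.bounds, hp'] with x hx h1
    rw [h1]
    exact step_p_mem hε hτ hx.1.1 hx.2.1.1 hx.2.2.1 hx.2.2.2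
  have hm : AEStronglyMeasurable p' volume := by
    have hu := h.memLp_u.1.aemeasurable
    have hv := h.memLp_v.1.aemeasurable
    have hp := h.aestronglyMeasurable_p.aemeasurable
    exact ((hp.add (hu.const_mul _)).div
      (((hu.add hv).const_mul _).const_add 1)).aestronglyMeasurable.congr hp'.symm
  refine ⟨memLp_top_of_bound hm 1 ?_, hb⟩
  filter_upwards [hb] with x hx
  rw [Real.norm_eq_abs, abs_of_nonneg hx.1]
  exact hx.2

/-- The absorption coefficient of the equation for `u`. -/
lemma coeff_u (hlam : 0 < lam) (h : IsAdmissible U V u v p) (hp' : MemLp p' ∞ volume)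
    (hp1 : ∀ᵐ x, 0 ≤ p' x ∧ p' x ≤ 1) :
    MemLp (fun x => v x + lam * (1 - p' x)) ∞ volume ∧ ∀ᵐ x, 0 ≤ v x + lam * (1 - p' x) := by
  refine ⟨h.memLp_v.add (((memLp_top_const (1 : ℝ)).sub hp').const_mul lam), ?_⟩
  filter_upwards [h.bounds, hp1] with x hx h1
  exact add_nonneg hx.2.1.1 (mul_nonneg hlam.le (sub_nonneg.2 h1.2))

/-- The absorption coefficient of the equation for `v`. -/
lemma coeff_v (hlam : 0 < lam) (hu' : MemLp u' ∞ volume) (hu0 : ∀ᵐ x, 0 ≤ u' x)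
    (hp' : MemLp p' ∞ volume) (hp1 : ∀ᵐ x, 0 ≤ p' x ∧ p' x ≤ 1) :
    MemLp (fun x => u' x + lam * p' x) ∞ volume ∧ ∀ᵐ x, 0 ≤ u' x + lam * p' x := by
  refine ⟨hu'.add (hp'.const_mul lam), ?_⟩
  filter_upwards [hu0, hp1] with x hx h1
  exact add_nonneg hx (mul_nonneg hlam.le h1.1)

end IsAdmissible

/-- One implicit diffusion step with nonnegative absorption preserves the bounds `0` and `M`. -/
lemma SolvesElliptic.ae_mem (hε : 0 < ε) (hτ : 0 < τ) (hD : 0 < D) (hc : MemLp c ∞ volume)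
    (hc0 : ∀ᵐ x, 0 ≤ c x) (hf : MemLp f ∞ volume) {M : ℝ} (hM : 0 ≤ M)
    (hfM : ∀ᵐ x, 0 ≤ f x ∧ f x ≤ M)
    (h : SolvesElliptic (fun x => 1 + τ / ε * c x) (D * τ) w f) : ∀ᵐ x, 0 ≤ w x ∧ w x ≤ M := by
  have ha := memLp_one_add_mul (τ / ε) hc
  have ha1 := ae_one_le_one_add_mul (div_pos hτ hε).le hc0
  filter_upwards [h.ae_nonneg (mul_pos hD hτ) ha ha1 hf (hfM.mono fun _ hx => hx.1),
    h.ae_le_const (mul_pos hD hτ) ha ha1 hf hM (hfM.mono fun _ hx => hx.2)] with x h1 h2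
    using ⟨h1, h2⟩

variable (hε : 0 < ε) (hτ : 0 < τ) (hlam : 0 < lam) (hd₁ : 0 < d₁) (hd₂ : 0 < d₂)
include hε hτ hlam hd₁

lemma IsSchemeStep.ae_mem_u (hU : 0 ≤ U) (h : IsAdmissible U V u v p)
    (hs : IsSchemeStep ε τ lam d₁ d₂ u v p u' v' p') : ∀ᵐ x, 0 ≤ u' x ∧ u' x ≤ U := by
  obtain ⟨hp', hp1⟩ := h.next_p hε hτ ((h.ae_p_eq_iff hε hτ).1 hs.eq_p)
  obtain ⟨hc, hc0⟩ := h.coeff_u hlam hp' hp1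
  exact ((solvesElliptic_iff_step hτ hs.memLp_u).2 hs.eq_u).ae_mem hε hτ hd₁ hc hc0 h.memLp_u hU
    (h.bounds.mono fun _ hx => hx.1)

include hd₂

lemma IsSchemeStep.isAdmissible (hU : 0 ≤ U) (hV : 0 ≤ V) (h : IsAdmissible U V u v p)
    (hs : IsSchemeStep ε τ lam d₁ d₂ u v p u' v' p') : IsAdmissible U V u' v' p' := by
  obtain ⟨hp', hp1⟩ := h.next_p hε hτ ((h.ae_p_eq_iff hε hτ).1 hs.eq_p)
  have hu := hs.ae_mem_u hε hτ hlam hd₁ hU h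
  obtain ⟨hc, hc0⟩ := IsAdmissible.coeff_v hlam hs.memLp_u (hu.mono fun _ hx => hx.1) hp' hp1
  have hv := ((solvesElliptic_iff_step hτ hs.memLp_v).2 hs.eq_v).ae_mem hε hτ hd₂ hc hc0
    h.memLp_v hV (h.bounds.mono fun _ hx => hx.2.1)
  refine ⟨hs.memLp_u, hs.memLp_v, hp'.1, ?_⟩
  filter_upwards [hu, hv, hp1] with x h1 h2 h3 using ⟨h1, h2, h3⟩

lemma IsAdmissible.exists_isSchemeStep (hU : 0 ≤ U) (h : IsAdmissible U V u v p) :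
    ∃ u' v' p', IsSchemeStep ε τ lam d₁ d₂ u v p u' v' p' := by
  let p' := fun x => (p x + τ / ε * u x) / (1 + τ / ε * (u x + v x))
  obtain ⟨hp', hp1⟩ := h.next_p (p' := p') hε hτ .rfl
  obtain ⟨hc, hc0⟩ := h.coeff_u hlam hp' hp1
  obtain ⟨u', hu'⟩ := exists_solvesElliptic (mul_pos hd₁ hτ) (memLp_one_add_mul (τ / ε) hc)
    (ae_one_le_one_add_mul (div_pos hτ hε).le hc0) h.memLp_u
  have hu0 := hu'.ae_mem hε hτ hd₁ hc hc0 h.memLp_u hU (h.bounds.mono fun _ hx => hx.1)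
  obtain ⟨hc', hc0'⟩ := IsAdmissible.coeff_v hlam hu'.1 (hu0.mono fun _ hx => hx.1) hp' hp1
  obtain ⟨v', hv'⟩ := exists_solvesElliptic (mul_pos hd₂ hτ) (memLp_one_add_mul (τ / ε) hc')
    (ae_one_le_one_add_mul (div_pos hτ hε).le hc0') h.memLp_v
  exact ⟨u', v', p', hu'.1, hv'.1, (h.ae_p_eq_iff hε hτ).2 .rfl,
    (solvesElliptic_iff_step hτ hu'.1).1 hu', (solvesElliptic_iff_step hτ hv'.1).1 hv'⟩

/-- Steps from almost everywhere equal states lead to almost everywhere equal states. -/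
lemma IsSchemeStep.ae_eq (hU : 0 ≤ U) (h : IsAdmissible U V u v p)
    {ut vt pt ut' vt' pt' : EuclideanSpace ℝ (Fin d) → ℝ}
    (hs : IsSchemeStep ε τ lam d₁ d₂ u v p u' v' p')
    (hst : IsSchemeStep ε τ lam d₁ d₂ ut vt pt ut' vt' pt')
    (hu : u =ᵐ[volume] ut) (hv : v =ᵐ[volume] vt) (hp : p =ᵐ[volume] pt) :
    u' =ᵐ[volume] ut' ∧ v' =ᵐ[volume] vt' ∧ p' =ᵐ[volume] pt' := by
  have hpe := (h.ae_p_eq_iff hε hτ).1 hs.eq_p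
  have hpp : p' =ᵐ[volume] pt' := by
    filter_upwards [hpe, ((h.congr hu hv hp).ae_p_eq_iff hε hτ).1 hst.eq_p, hu, hv, hp]
      with x h1 h2 h3 h4 h5
    rw [h1, h2, h3, h4, h5]
  obtain ⟨hp', hp1⟩ := h.next_p hε hτ hpe
  obtain ⟨hc, hc0⟩ := h.coeff_u hlam hp' hp1
  have hk := (div_pos hτ hε).le
  have huu : u' =ᵐ[volume] ut' := by
    refine ((solvesElliptic_iff_step hτ hs.memLp_u).2 hs.eq_u).ae_eq (mul_pos hd₁ hτ)
      (memLp_one_add_mul _ hc) (ae_one_le_one_add_mul hk hc0) h.memLp_u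
      (((solvesElliptic_iff_step hτ hst.memLp_u).2 hst.eq_u).congr ?_ hu.symm)
    filter_upwards [hv, hpp] with x h1 h2
    rw [h1, h2]
  obtain ⟨hc', hc0'⟩ := IsAdmissible.coeff_v hlam hs.memLp_u
    ((hs.ae_mem_u hε hτ hlam hd₁ hU h).mono fun _ hx => hx.1) hp' hp1
  refine ⟨huu, ?_, hpp⟩
  refine ((solvesElliptic_iff_step hτ hs.memLp_v).2 hs.eq_v).ae_eq (mul_pos hd₂ hτ)
    (memLp_one_add_mul _ hc') (ae_one_le_one_add_mul hk hc0') h.memLp_v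
    (((solvesElliptic_iff_step hτ hst.memLp_v).2 hst.eq_v).congr ?_ hv.symm)
  filter_upwards [huu, hpp] with x h1 h2
  rw [h1, h2]

variable {u0 v0 p0 : EuclideanSpace ℝ (Fin d) → ℝ}

/-- The scheme is iterated on the subtype of admissible states. -/
lemma IsAdmissible.exists_isSemiImplicitSolution (hU : 0 ≤ U) (hV : 0 ≤ V)
    (h0 : IsAdmissible U V u0 v0 p0) :
    ∃ u v p, IsSemiImplicitSolution ε τ lam d₁ d₂ u0 v0 p0 u v p := by
  let X := EuclideanSpace ℝ (Fin d) → ℝ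
  have hstep (z : {z : X × X × X // IsAdmissible U V z.1 z.2.1 z.2.2}) :
      ∃ z' : {z : X × X × X // IsAdmissible U V z.1 z.2.1 z.2.2},
        IsSchemeStep ε τ lam d₁ d₂ z.1.1 z.1.2.1 z.1.2.2 z'.1.1 z'.1.2.1 z'.1.2.2 := by
    obtain ⟨u', v', p', hs⟩ := z.2.exists_isSchemeStep hε hτ hlam hd₁ hd₂ hU
    exact ⟨⟨(u', v', p'), hs.isAdmissible hε hτ hlam hd₁ hd₂ hU hV z.2⟩, hs⟩
  choose next hnext using hstep
  let z : ℕ → {z : X × X × X // IsAdmissible U V z.1 z.2.1 z.2.2} :=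
    fun n => next^[n] ⟨(u0, v0, p0), h0⟩
  have hz (n : ℕ) : IsSchemeStep ε τ lam d₁ d₂ (z n).1.1 (z n).1.2.1 (z n).1.2.2
      (z (n + 1)).1.1 (z (n + 1)).1.2.1 (z (n + 1)).1.2.2 := by
    have : z (n + 1) = next (z n) := Function.iterate_succ_apply' _ _ _
    rw [this]
    exact hnext (z n)
  exact ⟨fun n => (z n).1.1, fun n => (z n).1.2.1, fun n => (z n).1.2.2,
    fun n => (z n).2.memLp_u, fun n => (z n).2.memLp_v, .rfl, .rfl, .rfl,
    fun n => (hz n).eq_p, fun n => (hz n).eq_u, fun n => (hz n).eq_v⟩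

lemma IsSemiImplicitSolution.isAdmissible (hU : 0 ≤ U) (hV : 0 ≤ V)
    (h0 : IsAdmissible U V u0 v0 p0) {u v p : ℕ → EuclideanSpace ℝ (Fin d) → ℝ}
    (h : IsSemiImplicitSolution ε τ lam d₁ d₂ u0 v0 p0 u v p) (n : ℕ) :
    IsAdmissible U V (u n) (v n) (p n) := by
  induction n with
  | zero => exact h0.congr h.initial_u.symm h.initial_v.symm h.initial_p.symm
  | succ n ih => exact (h.isSchemeStep n).isAdmissible hε hτ hlam hd₁ hd₂ hU hV ih

lemma IsSemiImplicitSolution.ae_eq (hU : 0 ≤ U) (hV : 0 ≤ V)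
    (h0 : IsAdmissible U V u0 v0 p0) {u v p u' v' p' : ℕ → EuclideanSpace ℝ (Fin d) → ℝ}
    (h : IsSemiImplicitSolution ε τ lam d₁ d₂ u0 v0 p0 u v p)
    (h' : IsSemiImplicitSolution ε τ lam d₁ d₂ u0 v0 p0 u' v' p') (n : ℕ) :
    u n =ᵐ[volume] u' n ∧ v n =ᵐ[volume] v' n ∧ p n =ᵐ[volume] p' n := by
  induction n with
  | zero => exact ⟨h.initial_u.trans h'.initial_u.symm, h.initial_v.trans h'.initial_v.symm,
      h.initial_p.trans h'.initial_p.symm⟩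
  | succ n ih =>
    exact (h.isSchemeStep n).ae_eq hε hτ hlam hd₁ hd₂ hU
      (h.isAdmissible hε hτ hlam hd₁ hd₂ hU hV h0 n) (h'.isSchemeStep n) ih.1 ih.2.1 ih.2.2

end Scheme

theorem lemma1 (d : ℕ) (ε τ lam d₁ d₂ : ℝ)
    (hε : 0 < ε) (hτ : 0 < τ) (hlam : 0 < lam) (hd₁ : 0 < d₁) (hd₂ : 0 < d₂) :
    -- the scheme is well posed in `L^∞` and preserves the bounds of the initial data
    (∀ u0 v0 p0 : EuclideanSpace ℝ (Fin d) → ℝ,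
      MemLp u0 ∞ volume → MemLp v0 ∞ volume → AEStronglyMeasurable p0 volume →
      WithinBounds (supNorm u0) (supNorm v0) u0 v0 p0 →
      (∃ u v p, IsSemiImplicitSolution ε τ lam d₁ d₂ u0 v0 p0 u v p) ∧
      (∀ u v p u' v' p', IsSemiImplicitSolution ε τ lam d₁ d₂ u0 v0 p0 u v p →
        IsSemiImplicitSolution ε τ lam d₁ d₂ u0 v0 p0 u' v' p' →
        ∀ n, u n =ᵐ[volume] u' n ∧ v n =ᵐ[volume] v' n ∧ p n =ᵐ[volume] p' n) ∧
      (∀ u v p, IsSemiImplicitSolution ε τ lam d₁ d₂ u0 v0 p0 u v p →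
        ∀ n, WithinBounds (supNorm u0) (supNorm v0) (u n) (v n) (p n))) ∧
    -- `(1 + (τ/ε) c) - D τ Δ` is invertible on `L^∞`, and its inverse is positivity preserving
    -- and contractive, for each of the diffusion coefficients
    (∀ D : ℝ, D = d₁ ∨ D = d₂ →
      ∀ c : EuclideanSpace ℝ (Fin d) → ℝ, MemLp c ∞ volume → (∀ᵐ x, 0 ≤ c x) →
      (∀ f : EuclideanSpace ℝ (Fin d) → ℝ, MemLp f ∞ volume →
        (∃ w, SolvesElliptic (fun x => 1 + τ / ε * c x) (D * τ) w f) ∧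
        (∀ w w', SolvesElliptic (fun x => 1 + τ / ε * c x) (D * τ) w f →
          SolvesElliptic (fun x => 1 + τ / ε * c x) (D * τ) w' f → w =ᵐ[volume] w') ∧
        (∀ w, SolvesElliptic (fun x => 1 + τ / ε * c x) (D * τ) w f →
          ((∀ᵐ x, 0 ≤ f x) → ∀ᵐ x, 0 ≤ w x) ∧ supNorm w ≤ supNorm f))) := by
  refine ⟨fun u0 v0 p0 hu hv hp hb => ?_, fun D hD c hc hc0 f hf => ?_⟩
  · have h0 : IsAdmissible (supNorm u0) (supNorm v0) u0 v0 p0 := ⟨hu, hv, hp, hb⟩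
    have hU : 0 ≤ supNorm u0 := ENNReal.toReal_nonneg
    have hV : 0 ≤ supNorm v0 := ENNReal.toReal_nonneg
    exact ⟨h0.exists_isSemiImplicitSolution hε hτ hlam hd₁ hd₂ hU hV,
      fun u v p u' v' p' h h' => h.ae_eq hε hτ hlam hd₁ hd₂ hU hV h0 h',
      fun u v p h n => (h.isAdmissible hε hτ hlam hd₁ hd₂ hU hV h0 n).bounds⟩
  · have hκ : 0 < D * τ := mul_pos (by rcases hD with rfl | rfl <;> assumption) hτ
    have ha := memLp_one_add_mul (τ / ε) hc
    have ha1 := ae_one_le_one_add_mul (div_pos hτ hε).le hc0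
    refine ⟨exists_solvesElliptic hκ ha ha1 hf, fun w w' h h' => h.ae_eq hκ ha ha1 hf h',
      fun w h => ⟨h.ae_nonneg hκ ha ha1 hf, ?_⟩⟩
    have hM : 0 ≤ supNorm f := ENNReal.toReal_nonneg
    have hfM : ∀ᵐ x, |f x| ≤ supNorm f := hf.ae_abs_le
    refine toReal_eLpNorm_top_le hM ?_
    filter_upwards [h.ae_le_const hκ ha ha1 hf hM (hfM.mono fun _ hx => (abs_le.1 hx).2),
      h.const_le_ae hκ ha ha1 hf (neg_nonpos.2 hM) (hfM.mono fun _ hx => (abs_le.1 hx).1)]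
      with x h1 h2 using abs_le.2 ⟨h2, h1⟩
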